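/- Let $\mathcal H$ be a real Hilbert space. For $f:\mathcal H\to\mathbb R\cup\{\pm\infty\}$ let $\partial f(x)=\{u : f(y)\ge f(x)+\langle u,y-x\rangle\ \forall y\in\mathcal H\}$. For $\mu\in[0,\infty)$ and $L\in(0,\infty]$ let $\mathcal F_{\mu,L}$ be the set of convex, closed, proper functions on $\mathcal H$ that are $\mu$-strongly convex (no condition if $\mu=0$) and $L$-smooth, i.e. finite and differentiable everywhere with $L$-Lipschitz gradient (no condition if $L=\infty$). For $\alpha,\lambda>0$ let $$T=I-\lambda J_{\alpha\partial g}+\lambda J_{\alpha\partial f}\,(2J_{\alpha\partial g}-I-\alpha\,\partial h\,J_{\alpha\partial g}),\qquad J_{\alpha A}=(I+\alpha A)^{-1},$$ be the Davis--Yin operator of $f,g,h$ (here $\partial h=\nabla h$). Call $T$ $\rho$-contractive if $\|u-v\|\le\rho\|x-y\|$ for all $u\in Tx$, $v\in Ty$ ($\rho=1$ is allowed). Let $\alpha>0$, $\lambda>0$, $0<L_h<\infty$, $\alpha L_h<4$ and $\lambda<2-\frac{\alpha L_h}{2}$. Below, $L_f\in(0,\infty]$, and for $L_f=\infty$ every quotient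 containing $L_f$ in its denominator is read as $0$. 1. Let $0\le\mu_f<L_f\le\infty$ and put $\theta=\frac{2}{4-\alpha L_h}$, $$\rho_{\rm old}=1-\lambda\theta+\lambda\sqrt{\theta\Big(\theta-\tfrac{2\alpha\mu_f}{\alpha^2L_f^2+2\alpha\mu_f+1}\Big)},\qquad \rho_{\rm new}=1-\lambda\theta+\lambda\sqrt{\theta\Big(\theta-\alpha\min\Big\{\tfrac{2\mu_f}{(1+\alpha\mu_f)^2},\tfrac{2L_f}{(1+\alpha L_f)^2}\Big\}\Big)}.$$ For all $f\in\mathcal F_{\mu_f,L_f}$, $g\in\mathcal F_{0,\infty}$, $h\in\mathcal F_{0,L_h}$, $T$ is $\rho_{\rm old}$-contractive and $\rho_{\rm new}$-contractive. Moreover $\rho_{\rm new}\le\rho_{\rm old}$; if $\mu_f>0$ and $L_f<\infty$, then $\rho_{\rm new}<\rho_{\rm old}<1$; if $\mu_f=0$, then $\rho_{\rm new}=\rho_{\rm old}$. 2. Let $0\le\mu_g<\infty$, $0<L_f\le\infty$ and put $q=\frac{(2-\lambda)(\mu_g+L_f)+2\alpha\mu_gL_f}{(1+\alpha L_f)^2(2-\lambda+2\alpha\mu_g)}$,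 $$\rho_{\rm old}=\sqrt{1-2\lambda\alpha\min\Big\{\tfrac{(2-\lambda)\mu_g}{(1+\alpha^2L_f^2)(2-\lambda+2\alpha\mu_g)},\,q\Big\}},\qquad \rho_{\rm new}=\sqrt{1-2\lambda\alpha\min\Big\{\tfrac{(2-\lambda)\mu_g}{2-\lambda+2\alpha\mu_g},\,q\Big\}}.$$ For all $f\in\mathcal F_{0,L_f}$, $g\in\mathcal F_{\mu_g,\infty}$, $h\in\mathcal F_{0,L_h}$, $T$ is $\rho_{\rm old}$-contractive and $\rho_{\rm new}$-contractive. Moreover $\rho_{\rm new}\le\rho_{\rm old}$; if $\mu_g>0$ and $L_f<\infty$, then $\rho_{\rm old}<1$; if in addition $(2-\lambda)(1-2\alpha\mu_g+\alpha^2L_f^2)+2\alpha\mu_g(1+\alpha^2L_f^2)>0$, then $\rho_{\rm new}<\rho_{\rm old}$. 3. Let $0\le\mu_h<L_h$, $0<L_f\le\infty$ and put $c=\mu_h\big(1-\frac{\alpha L_h}{2(2-\lambda)}\big)$, $\xi=\min\big\{\mu_h\big(1-\frac{\alpha\mu_h}{2(2-\lambda)}\big),\,L_h\big(1-\frac{\alpha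 L_h}{2(2-\lambda)}\big)\big\}$, $$\rho_{\rm old}=\sqrt{1-2\lambda\alpha\min\Big\{\tfrac{c}{1+\alpha^2L_f^2},\tfrac{L_f+c}{(1+\alpha L_f)^2}\Big\}},\qquad \rho_{\rm new}=\sqrt{1-2\lambda\alpha\min\Big\{\xi,\tfrac{L_f+\xi}{(1+\alpha L_f)^2}\Big\}}.$$ For all $f\in\mathcal F_{0,L_f}$, $g\in\mathcal F_{0,\infty}$, $h\in\mathcal F_{\mu_h,L_h}$, $T$ is $\rho_{\rm old}$-contractive and $\rho_{\rm new}$-contractive. Moreover $\rho_{\rm new}\le\rho_{\rm old}$; if $\mu_h>0$ and $L_f<\infty$, then $\rho_{\rm new}<\rho_{\rm old}<1$; if $\mu_h=0$, then $\rho_{\rm new}=\rho_{\rm old}$. -/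

import Mathlib

noncomputable section

/-! ### Multi-valued operators on a real Hilbert space -/

/-- A multi-valued operator on `H`: every point is sent to a set of values. -/
abbrev MultiOp (H : Type*) := H → Set H

namespace MultiOp

variable {H : Type*} [NormedAddCommGroup H] [InnerProductSpace ℝ H]

/-- The identity operator. -/
def ident : MultiOp H := fun x => {x}

/-- The sum `A + B = {(x, u + v) | (x, u) ∈ A, (x, v) ∈ B}`. -/
def add (A B : MultiOp H) : MultiOp H := fun x => {w | ∃ u ∈ A x, ∃ v ∈ B x, w = u + v}

/-- The multiple `c A = {(x, c u) | (x, u) ∈ A}`. -/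
def smul (c : ℝ) (A : MultiOp H) : MultiOp H := fun x => {w | ∃ u ∈ A x, w = c • u}

/-- The composition `A B = {(x, s) | ∃ u, (x, u) ∈ B, (u, s) ∈ A}`. -/
def comp (A B : MultiOp H) : MultiOp H := fun x => {s | ∃ u ∈ B x, s ∈ A u}

/-- The inverse `A⁻¹ = {(u, x) | (x, u) ∈ A}`. -/
def inv (A : MultiOp H) : MultiOp H := fun u => {x | u ∈ A x}

/-- The resolvent `J_{αA} = (I + α A)⁻¹`. -/
def resolvent (α : ℝ) (A : MultiOp H) : MultiOp H := inv (add ident (smul α A))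

/-- The Davis--Yin operator
`I - lam J_{αB} + lam J_{αA} (2 J_{αB} - I - α C J_{αB})`. -/
def davisYin (A B C : MultiOp H) (α lam : ℝ) : MultiOp H :=
  add (add ident (smul (-lam) (resolvent α B)))
    (smul lam
      (comp (resolvent α A)
        (add (add (smul 2 (resolvent α B)) (smul (-1) ident))
          (smul (-α) (comp C (resolvent α B))))))

/-- `T` is Lipschitz with factor `ρ` on its graph. -/
def IsContractive (ρ : ℝ) (T : MultiOp H) : Prop :=
  ∀ x y : H, ∀ u ∈ T x, ∀ v ∈ T y, ‖u - v‖ ≤ ρ * ‖x - y‖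

end MultiOp

/-! ### Extended real-valued convex functions -/

section ConvexFunctions

variable {H : Type*} [NormedAddCommGroup H] [InnerProductSpace ℝ H]

/-- The subdifferential `∂f(x) = {g | f(y) ≥ f(x) + ⟨g, y - x⟩ for all y}`. -/
def subdiff (f : H → EReal) : MultiOp H :=
  fun x => {g | ∀ y : H, f x + ((inner ℝ g (y - x) : ℝ) : EReal) ≤ f y}

/-- Convex (convex epigraph), closed (lower semicontinuous) and proper functions. -/
structure IsCCP (f : H → EReal) : Prop where
  convex : Convex ℝ {p : H × ℝ | f p.1 ≤ (p.2 : EReal)}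
  closed : LowerSemicontinuous f
  ne_bot : ∀ x, f x ≠ ⊥
  exists_ne_top : ∃ x, f x ≠ ⊤

/-- `μ`-strong convexity of an extended real-valued function. -/
def IsStronglyConvex (μ : ℝ) (f : H → EReal) : Prop :=
  ∀ x y : H, ∀ t : ℝ, 0 ≤ t → t ≤ 1 →
    f (t • x + (1 - t) • y) + ((μ / 2 * (t * (1 - t)) * ‖x - y‖ ^ 2 : ℝ) : EReal)
      ≤ (t : EReal) * f x + ((1 - t : ℝ) : EReal) * f y

/-- `L`-smoothness: `f` is finite and differentiable everywhere, and its gradient is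
`L`-Lipschitz. -/
def IsSmooth [CompleteSpace H] (L : ℝ) (f : H → EReal) : Prop :=
  ∃ (F : H → ℝ) (G : H → H), (∀ x, f x = (F x : EReal)) ∧
    (∀ x, HasGradientAt F (G x) x) ∧ ∀ x y, ‖G x - G y‖ ≤ L * ‖x - y‖

/-- The class `𝓕_{μ,L}`; strong convexity is not required when `μ = 0`, and smoothness is not
required when `L = ∞`. -/
structure FunClass [CompleteSpace H] (μ : ℝ) (L : EReal) (f : H → EReal) : Prop where
  ccp : IsCCP f
  strong : 0 < μ → IsStronglyConvex μ f
  smooth : L ≠ ⊤ → IsSmooth L.toReal f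

end ConvexFunctions

/-! ### The contraction factors -/

open Classical in
/-- The value at `L ∈ ℝ ∪ {∞}` of a quotient `q(L)` whose denominator grows faster in `L` than
its numerator, with the conventions `r / ∞ = 0` and `∞ / ∞² = 0`. -/
def quotAt (q : ℝ → ℝ) (L : EReal) : ℝ := if L = ⊤ then 0 else q L.toReal

/-- Old factor, `f` strongly convex and smooth. -/
def rhoOldF (α lam μf : ℝ) (Lf : EReal) (Lh : ℝ) : ℝ :=
  1 - 2 * lam / (4 - α * Lh) + lam * √(2 / (4 - α * Lh) *
    (2 / (4 - α * Lh) - quotAt (fun L => 2 * α * μf / (α ^ 2 * L ^ 2 + 2 * α * μf + 1)) Lf))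

/-- New factor, `f` strongly convex and smooth. -/
def rhoNewF (α lam μf : ℝ) (Lf : EReal) (Lh : ℝ) : ℝ :=
  1 - 2 * lam / (4 - α * Lh) + lam * √(2 / (4 - α * Lh) *
    (2 / (4 - α * Lh) -
      α * min (2 * μf / (1 + α * μf) ^ 2) (quotAt (fun L => 2 * L / (1 + α * L) ^ 2) Lf)))

/-- Old factor, `g` strongly convex. -/
def rhoOldG (α lam μg : ℝ) (Lf : EReal) : ℝ :=
  √(1 - 2 * lam * α * min
    (quotAt (fun L => (2 - lam) * μg / ((1 + α ^ 2 * L ^ 2) * (2 - lam + 2 * α * μg))) Lf)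
    (quotAt (fun L => ((2 - lam) * (μg + L) + 2 * α * μg * L) /
      ((1 + α * L) ^ 2 * (2 - lam + 2 * α * μg))) Lf))

/-- New factor, `g` strongly convex. -/
def rhoNewG (α lam μg : ℝ) (Lf : EReal) : ℝ :=
  √(1 - 2 * lam * α * min
    ((2 - lam) * μg / (2 - lam + 2 * α * μg))
    (quotAt (fun L => ((2 - lam) * (μg + L) + 2 * α * μg * L) /
      ((1 + α * L) ^ 2 * (2 - lam + 2 * α * μg))) Lf))

/-- Old factor, `h` strongly convex. -/
def rhoOldH (α lam : ℝ) (Lf : EReal) (μh Lh : ℝ) : ℝ :=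
  √(1 - 2 * lam * α * min
    (quotAt (fun L => μh * (1 - α * Lh / (2 * (2 - lam))) / (1 + α ^ 2 * L ^ 2)) Lf)
    (quotAt (fun L => (L + μh * (1 - α * Lh / (2 * (2 - lam)))) / (1 + α * L) ^ 2) Lf))

/-- The quantity `ξ` in the new factor, `h` strongly convex. -/
def xiH (α lam μh Lh : ℝ) : ℝ :=
  min (μh * (1 - α * μh / (2 * (2 - lam)))) (Lh * (1 - α * Lh / (2 * (2 - lam))))

/-- New factor, `h` strongly convex. -/
def rhoNewH (α lam : ℝ) (Lf : EReal) (μh Lh : ℝ) : ℝ :=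
  √(1 - 2 * lam * α * min (xiH α lam μh Lh)
    (quotAt (fun L => (L + xiH α lam μh Lh) / (1 + α * L) ^ 2) Lf))

end

/-! Fix two evaluations of `T` and write a, b for the differences of the points at which g (and h)
and f are evaluated, and u, w, v for α times the differences of the subgradients of g, h, f. With x
= a + u and d = a - b, the inputs differ by x, the outputs by x - λd, and a - u - w = b + v.
Everything reduces to quadratic inequalities between these vectors. The only facts used about f, g,
h are (strong) monotonicity and the interpolation inequality ⟨L d - e, e - μ d⟩ ≥ 0 for point
differences d and gradient differences e: e lies in the ball with diameter from μd to Ld.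

If f is strongly convex, put θ = 2/(4 - αL_h) and write x - λd = (1 - λθ)x + λ(θx - d). The vector
θx - d is a term depending on a, u, w only plus the deviation of b from half of the resolvent
argument b + v. Strong convexity and smoothness of f bound the deviation, monotonicity of g and
cocoercivity of h bound the other term, and Cauchy-Schwarz combines them
(`norm_averaged_displacement_le`).

If g or h is strongly convex, expand ‖x - λd‖² = ‖x‖² - 2λ(⟨x,d⟩ - (λ/2)‖d‖²) and bound the bracket
below by a multiple of ‖x‖². The two cases differ only in the modulus ν that g and h jointly supply
(`isContractive_of_joint_bound`). The lower bound rests on an explicit sum-of-squares identity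
(`certificate_identity`, `displacement_bound`).

The old factors are never smaller than the new ones, so their contractivity follows; the comparisons
are inequalities between rational functions. -/

/-! ### Subgradient inequalities and interpolation for smooth strongly convex functions. -/

section Subgradients

variable {H : Type*} [NormedAddCommGroup H] [InnerProductSpace ℝ H]

/-- A proper function is finite wherever it has a subgradient. -/
theorem IsCCP.exists_eq_coe_of_mem_subdiff {f : H → EReal} (hf : IsCCP f) {x u : H}
    (hu : u ∈ subdiff f x) : ∃ r : ℝ, f x = (r : EReal) := by
  obtain ⟨z, hz⟩ := hf.exists_ne_top
  have hle := hu z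
  have htop : f x ≠ ⊤ := by
    intro h
    rw [h, EReal.top_add_coe] at hle
    exact hz (top_le_iff.1 hle)
  exact ⟨(f x).toReal, (EReal.coe_toReal htop (hf.ne_bot x)).symm⟩

/-- The subgradient inequality with the quadratic gain given by strong convexity. -/
theorem subgradient_inequality {f : H → EReal} {μ : ℝ} (hμ : 0 ≤ μ)
    (hf : 0 < μ → IsStronglyConvex μ f) {x z u : H} (hu : u ∈ subdiff f x) {r r' : ℝ}
    (hx : f x = (r : EReal)) (hz : f z = (r' : EReal)) :
    r + inner ℝ u (z - x) + μ / 2 * ‖z - x‖ ^ 2 ≤ r' := by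
  rcases hμ.eq_or_lt with rfl | hpos
  · have h := hu z
    rw [hx, hz] at h
    have h' : r + inner ℝ u (z - x) ≤ r' := by exact_mod_cast h
    linarith
  -- Compare strong convexity on the segment from x to z with the subgradient inequality at its
  -- point of parameter t, divide by t, and let t tend to 0.
  have key : ∀ t : ℝ, 0 < t → t ≤ 1 →
      r + inner ℝ u (z - x) + μ / 2 * (1 - t) * ‖z - x‖ ^ 2 ≤ r' := by
    intro t ht ht1
    have h1 := hf hpos z x t ht.le ht1
    have h2 := hu (t • z + (1 - t) • x)
    have hd : t • z + (1 - t) • x - x = t • (z - x) := by module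
    rw [hd, real_inner_smul_right, hx] at h2
    rw [hx, hz] at h1
    have h3 := (add_le_add_left h2
      ((μ / 2 * (t * (1 - t)) * ‖z - x‖ ^ 2 : ℝ) : EReal)).trans h1
    have h4 : r + t * inner ℝ u (z - x) + μ / 2 * (t * (1 - t)) * ‖z - x‖ ^ 2
        ≤ t * r' + (1 - t) * r := by exact_mod_cast h3
    have h5 : t * (r + inner ℝ u (z - x) + μ / 2 * (1 - t) * ‖z - x‖ ^ 2) ≤ t * r' := by
      linarith
    exact le_of_mul_le_mul_left h5 ht
  have hlim : Filter.Tendsto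
      (fun t : ℝ => r + inner ℝ u (z - x) + μ / 2 * (1 - t) * ‖z - x‖ ^ 2)
      (nhdsWithin 0 (Set.Ioi 0))
      (nhds (r + inner ℝ u (z - x) + μ / 2 * (1 - 0) * ‖z - x‖ ^ 2)) := by
    apply Filter.Tendsto.mono_left _ nhdsWithin_le_nhds
    exact Continuous.tendsto (by fun_prop) 0
  have := le_of_tendsto hlim (by
    filter_upwards [Ioc_mem_nhdsGT (zero_lt_one' ℝ)] with t ht
    exact key t ht.1 ht.2)
  linarith

/-- The subdifferential of a `μ`-strongly convex function is `μ`-strongly monotone. -/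
theorem subdiff_strongly_monotone {f : H → EReal} (hccp : IsCCP f) {μ : ℝ} (hμ : 0 ≤ μ)
    (hf : 0 < μ → IsStronglyConvex μ f) {x y u v : H} (hu : u ∈ subdiff f x)
    (hv : v ∈ subdiff f y) : μ * ‖x - y‖ ^ 2 ≤ inner ℝ (x - y) (u - v) := by
  obtain ⟨r, hr⟩ := hccp.exists_eq_coe_of_mem_subdiff hu
  obtain ⟨r', hr'⟩ := hccp.exists_eq_coe_of_mem_subdiff hv
  have h1 := subgradient_inequality hμ hf hu hr hr'
  have h2 := subgradient_inequality hμ hf hv hr' hr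
  have h3 : inner ℝ u (y - x) = - inner ℝ (x - y) u := by
    rw [← neg_sub x y, inner_neg_right, real_inner_comm]
  rw [norm_sub_rev y x, h3] at h1
  rw [real_inner_comm] at h2
  rw [inner_sub_right]
  linarith

/-- The descent lemma for functions with Lipschitz gradient. -/
theorem descent_lemma [CompleteSpace H] {F : H → ℝ} {G : H → H} {L : ℝ}
    (hG : ∀ x, HasGradientAt F (G x) x) (hL : ∀ x y, ‖G x - G y‖ ≤ L * ‖x - y‖) (x z : H) :
    F z ≤ F x + inner ℝ (G x) (z - x) + L / 2 * ‖z - x‖ ^ 2 := by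
  set d := z - x with hd
  -- Along the segment, F minus its linearization minus the quadratic term has nonpositive
  -- derivative by the Lipschitz bound, so its value at 1 is at most its value at 0.
  have hderiv : ∀ t : ℝ, HasDerivAt
      (fun t : ℝ => F (x + t • d) - t * inner ℝ (G x) d - L / 2 * ‖d‖ ^ 2 * t ^ 2)
      (inner ℝ (G (x + t • d)) d - inner ℝ (G x) d - L / 2 * ‖d‖ ^ 2 * (2 * t)) t := by
    intro t
    have hline : HasDerivAt (fun t : ℝ => x + t • d) d t := by
      simpa using ((hasDerivAt_id t).smul_const d).const_add x
    have h1 := (hG (x + t • d)).hasFDerivAt.comp_hasDerivAt t hline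
    have h2 : HasDerivAt (fun t : ℝ => t * inner ℝ (G x) d) (inner ℝ (G x) d) t := by
      simpa using (hasDerivAt_id t).mul_const (inner ℝ (G x) d)
    have h3 : HasDerivAt (fun t : ℝ => L / 2 * ‖d‖ ^ 2 * t ^ 2) (L / 2 * ‖d‖ ^ 2 * (2 * t)) t := by
      simpa using (hasDerivAt_pow 2 t).const_mul (L / 2 * ‖d‖ ^ 2)
    exact ((h1.sub h2).sub h3).congr_deriv (by simp)
  have hanti := antitoneOn_of_deriv_nonpos (convex_Icc (0 : ℝ) 1)
    (fun t _ => (hderiv t).continuousAt.continuousWithinAt)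
    (fun t _ => (hderiv t).differentiableAt.differentiableWithinAt) (by
      intro t ht
      rw [interior_Icc] at ht
      rw [(hderiv t).deriv, ← inner_sub_left]
      have h1 := real_inner_le_norm (G (x + t • d) - G x) d
      have h2 := hL (x + t • d) x
      rw [add_sub_cancel_left, norm_smul, Real.norm_of_nonneg ht.1.le] at h2
      nlinarith [mul_le_mul_of_nonneg_right h2 (norm_nonneg d)])
  have h := hanti (Set.left_mem_Icc.2 zero_le_one) (Set.right_mem_Icc.2 zero_le_one) zero_le_one
  have hz : x + d = z := by rw [hd]; abel
  simp only [one_smul, zero_smul, add_zero, hz] at h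
  linarith

/-- A subgradient of a differentiable function is its gradient. -/
theorem eq_gradient_of_mem_subdiff [CompleteSpace H] {f : H → EReal} {F : H → ℝ} {x g u : H}
    (hF : ∀ x, f x = (F x : EReal)) (hg : HasGradientAt F g x) (hu : u ∈ subdiff f x) :
    u = g := by
  have hmin : IsLocalMin (fun y => F y - inner ℝ u y) x := by
    refine Filter.Eventually.of_forall fun y => ?_
    have h := hu y
    rw [hF, hF] at h
    have h' : F x + inner ℝ u (y - x) ≤ F y := by exact_mod_cast h
    rw [inner_sub_right] at h'
    show F x - inner ℝ u x ≤ F y - inner ℝ u y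
    linarith
  have hd := hg.hasFDerivAt.sub (innerSL ℝ u).hasFDerivAt (x := x)
  have h0 := hmin.hasFDerivAt_eq_zero hd
  have h1 := congrArg (fun T : H →L[ℝ] ℝ => T (g - u)) h0
  simp only [_root_.sub_apply, InnerProductSpace.toDual_apply_apply, innerSL_apply_apply,
    _root_.zero_apply, ← inner_sub_left] at h1
  exact (sub_eq_zero.1 (inner_self_eq_zero.1 h1)).symm

/-- Cocoercivity of the gradients of `L`-smooth `μ`-strongly convex functions. -/
theorem subdiff_interpolation [CompleteSpace H] {f : H → EReal} {μ L : ℝ} (hμ : 0 ≤ μ)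
    (hμL : μ < L) (hf : 0 < μ → IsStronglyConvex μ f) (hs : IsSmooth L f) {x y u v : H}
    (hu : u ∈ subdiff f x) (hv : v ∈ subdiff f y) :
    0 ≤ inner ℝ (L • (x - y) - (u - v)) ((u - v) - μ • (x - y)) := by
  obtain ⟨F, G, hF, hG, hL⟩ := hs
  have key : ∀ {x y u v : H}, u ∈ subdiff f x → v ∈ subdiff f y → ∀ z,
      F x + inner ℝ u (z - x) + μ / 2 * ‖z - x‖ ^ 2 ≤
        F y + inner ℝ v (z - y) + L / 2 * ‖z - y‖ ^ 2 := by
    intro x y u v hu hv z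
    have h1 := subgradient_inequality hμ hf hu (hF x) (hF z)
    have h2 := descent_lemma hG hL y z
    rw [← eq_gradient_of_mem_subdiff hF (hG y) hv] at h2
    exact h1.trans h2
  have hpos : 0 < L - μ := sub_pos.2 hμL
  set e : H := (u - v) - μ • (x - y) with he
  -- The test points minimize the gap between the quadratic upper model at one point and the
  -- quadratic lower model at the other. Adding the two inequalities eliminates the function values.
  have h1 := key hu hv (y + (L - μ)⁻¹ • e)
  have h2 := key hv hu (x - (L - μ)⁻¹ • e)
  set c : ℝ := (L - μ)⁻¹ with hc
  have hcL : c * (L - μ) = 1 := inv_mul_cancel₀ hpos.ne'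
  have hcpos : 0 < c := inv_pos.2 hpos
  set d : H := x - y with hd
  have e1 : y + c • e - x = c • e - d := by rw [hd]; abel
  have e2 : y + c • e - y = c • e := by abel
  have e3 : x - c • e - y = d - c • e := by rw [hd]; abel
  have e4 : x - c • e - x = -(c • e) := by abel
  rw [e1, e2] at h1
  rw [e3, e4] at h2
  have hun : u - v = e + μ • d := by rw [he]; abel
  rw [hun]
  have hue : inner ℝ u e = inner ℝ v e + ‖e‖ ^ 2 + μ * inner ℝ d e := by
    have : u = v + (e + μ • d) := by rw [← hun]; abel
    rw [this, inner_add_left, inner_add_left, real_inner_smul_left, real_inner_self_eq_norm_sq]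
    ring
  have hud : inner ℝ u d = inner ℝ v d + inner ℝ d e + μ * ‖d‖ ^ 2 := by
    have : u = v + (e + μ • d) := by rw [← hun]; abel
    rw [this, inner_add_left, inner_add_left, real_inner_smul_left, real_inner_self_eq_norm_sq,
      real_inner_comm e d]
    ring
  simp only [← real_inner_self_eq_norm_sq, inner_add_left, inner_sub_left, inner_sub_right,
    real_inner_smul_left, real_inner_smul_right, inner_neg_left, inner_neg_right,
    real_inner_comm d e] at h1 h2 hue hud ⊢
  rw [hue] at h1 h2
  rw [hud] at h1
  set A : ℝ := inner ℝ e e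
  set B : ℝ := inner ℝ d e
  set C : ℝ := inner ℝ d d
  have h3 : c * A ≤ B := by
    have hcc : c * c * (L - μ) = c := by rw [mul_assoc, hcL, mul_one]
    linear_combination h1 + h2 + hcc * A
  have h4 : A ≤ (L - μ) * B := by
    have := mul_le_mul_of_nonneg_left h3 hpos.le
    calc A = (L - μ) * (c * A) := by rw [← mul_assoc, mul_comm (L - μ), hcL, one_mul]
      _ ≤ _ := this
  linarith

end Subgradients

/-! ### Unfolding the multi-valued Davis–Yin operator. -/

section DavisYin

variable {H : Type*} [NormedAddCommGroup H] [InnerProductSpace ℝ H]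

/-- Here a - a' = -α(u - u'), so monotonicity gives -α‖u - u'‖² ≥ 0. -/
theorem resolvent_unique {α : ℝ} (hα : 0 < α) {A : MultiOp H}
    (hA : ∀ {x y u v : H}, u ∈ A x → v ∈ A y → 0 ≤ inner ℝ (x - y) (u - v)) {z a a' u u' : H}
    (hu : u ∈ A a) (hu' : u' ∈ A a') (h : z = a + α • u) (h' : z = a' + α • u') :
    a = a' ∧ u = u' := by
  have hmon := hA hu hu'
  have hd : a - a' = -(α • (u - u')) := by
    rw [smul_sub]
    have : a + α • u = a' + α • u' := h ▸ h'
    rw [eq_sub_of_add_eq this]; abel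
  rw [hd, inner_neg_left, real_inner_smul_left, real_inner_self_eq_norm_sq] at hmon
  have h0 : ‖u - u'‖ ^ 2 ≤ 0 := by nlinarith
  have h1 : u - u' = 0 := norm_eq_zero.1 (pow_eq_zero_iff two_ne_zero |>.1
    (le_antisymm h0 (sq_nonneg _)))
  refine ⟨?_, sub_eq_zero.1 h1⟩
  rw [h1, smul_zero, neg_zero] at hd
  exact sub_eq_zero.1 hd

theorem mem_resolvent {α : ℝ} {A : MultiOp H} {x z : H} :
    x ∈ MultiOp.resolvent α A z ↔ ∃ u ∈ A x, z = x + α • u := by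
  simp only [MultiOp.resolvent, MultiOp.inv, MultiOp.add, MultiOp.ident, MultiOp.smul,
    Set.mem_ofPred_eq, Set.mem_singleton_iff]
  constructor
  · rintro ⟨_, rfl, _, ⟨u, hu, rfl⟩, rfl⟩
    exact ⟨u, hu, rfl⟩
  · rintro ⟨u, hu, rfl⟩
    exact ⟨_, rfl, _, ⟨u, hu, rfl⟩, rfl⟩

/-- The points visited in one evaluation of the Davis--Yin operator. -/
theorem exists_of_mem_davisYin {α lam : ℝ} (hα : 0 < α) {A B C : MultiOp H}
    (hB : ∀ {x y u v : H}, u ∈ B x → v ∈ B y → 0 ≤ inner ℝ (x - y) (u - v)) {z t : H}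
    (ht : t ∈ MultiOp.davisYin A B C α lam z) :
    ∃ a u w b v, u ∈ B a ∧ w ∈ C a ∧ v ∈ A b ∧ z = a + α • u ∧
      a - α • u - α • w = b + α • v ∧ t = z - lam • (a - b) := by
  obtain ⟨_, ⟨_, hz, _, ⟨a, ha, rfl⟩, rfl⟩, _, ⟨b, hb, rfl⟩, rfl⟩ := ht
  obtain ⟨q, ⟨_, ⟨_, ⟨a', ha', rfl⟩, _, ⟨_, hz', rfl⟩, rfl⟩, _,
    ⟨w, ⟨a'', ha'', hw⟩, rfl⟩, rfl⟩, hb⟩ := hb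
  rw [MultiOp.ident, Set.mem_singleton_iff] at hz hz'
  subst hz
  subst hz'
  rw [mem_resolvent] at ha ha' ha'' hb
  obtain ⟨u, hu, h1⟩ := ha
  obtain ⟨u', hu', h2⟩ := ha'
  obtain ⟨u'', hu'', h3⟩ := ha''
  obtain ⟨v, hv, h4⟩ := hb
  -- The resolvent of B occurs three times in the operator, each with its own selection; uniqueness
  -- identifies them.
  obtain ⟨rfl, rfl⟩ := resolvent_unique hα hB hu hu' h1 h2
  obtain ⟨rfl, rfl⟩ := resolvent_unique hα hB hu hu'' h1 h3
  refine ⟨a, u, w, b, v, hu, hw, hv, h1, ?_, ?_⟩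
  · rw [← h4, h1]; module
  · module

/-- Contractivity of the Davis--Yin operator from a bound for the differences of the points
visited by two evaluations. -/
theorem isContractive_davisYin {α lam ρ : ℝ} (hα : 0 < α) {A B C : MultiOp H}
    (hB : ∀ {x y u v : H}, u ∈ B x → v ∈ B y → 0 ≤ inner ℝ (x - y) (u - v))
    (key : ∀ {a a' u u' w w' b b' v v' : H}, u ∈ B a → u' ∈ B a' → w ∈ C a → w' ∈ C a' →
      v ∈ A b → v' ∈ A b' →
      (a - a') - α • (u - u') - α • (w - w') = (b - b') + α • (v - v') →
      ‖(a - a') + α • (u - u') - lam • ((a - a') - (b - b'))‖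
        ≤ ρ * ‖(a - a') + α • (u - u')‖) :
    MultiOp.IsContractive ρ (MultiOp.davisYin A B C α lam) := by
  intro x y s hs t ht
  obtain ⟨a, u, w, b, v, hu, hw, hv, h1, h2, rfl⟩ := exists_of_mem_davisYin hα hB hs
  obtain ⟨a', u', w', b', v', hu', hw', hv', h1', h2', rfl⟩ := exists_of_mem_davisYin hα hB ht
  have e : x - y = (a - a') + α • (u - u') := by rw [h1, h1']; module
  have h := key hu hu' hw hw' hv hv' (by
    calc _ = (a - α • u - α • w) - (a' - α • u' - α • w') := by module
      _ = _ := by rw [h2, h2']; module)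
  rw [← e] at h
  convert h using 2
  module

end DavisYin

/-! ### Quadratic inequalities for one step of the iteration. -/

section Certificates

variable {H : Type*} [NormedAddCommGroup H] [InnerProductSpace ℝ H]

/-- Dual certificate for `displacement_bound_of_ratio`: target minus weighted hypotheses is a sum of
two squares. In the application s = λ/2, g = 1 - ν and k = 1/(1 + N), where f contributes
N⁻¹-cocoercivity. -/
theorem certificate_identity (a u w b : H) (s g k : ℝ) :
    4 * (1 - s * (1 + 3 * k - 2 * (g * k) - 2 * k * (g * k))) *
      ((1 - 2 * (g * k)) * (1 - k) * (g - s) *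
          (inner ℝ (a + u) (a - b) - s * ‖a - b‖ ^ 2 - k * (1 - g * k) * ‖a + u‖ ^ 2
            - (1 - 4 * (k * (1 - g * k)) * s) * inner ℝ a u)
        - (1 - 2 * (g * k)) * (1 - k) * (1 - 4 * (k * (1 - g * k)) * s) *
          ((1 - s) * (inner ℝ a w - (1 - g) * ‖a‖ ^ 2) - ‖w‖ ^ 2 / 4)
        - (g - s) * (1 - 4 * (k * (1 - g * k)) * s) *
          inner ℝ (b - k • (a - u - w)) (a - u - w - b)) =
    (g - s) * ‖(2 * (1 - s * (1 + 3 * k - 2 * (g * k) - 2 * k * (g * k)))) • b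
        - ((1 - 2 * (g * k)) * (1 - k)) • (a + u - (2 * s) • a)
        - ((1 - 4 * (k * (1 - g * k)) * s) * (1 + k)) • (a - u - w)‖ ^ 2
      + 4 * (1 - k) * (1 - 4 * (k * (1 - g * k)) * s) * (1 - g - g * k) *
        ‖(k * (g - s)) • u + (1 / 2 - k * s) • w
          - (1 - s - g * k + 2 * s * (g * k) - k * s) • a‖ ^ 2 := by
  simp only [← real_inner_self_eq_norm_sq, inner_add_left, inner_add_right, inner_sub_left,
    inner_sub_right, real_inner_smul_left, real_inner_smul_right,
    real_inner_comm a u, real_inner_comm a w, real_inner_comm a b,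
    real_inner_comm u w, real_inner_comm u b, real_inner_comm w b]
  ring

/-- The proof checks the signs of the coefficients in `certificate_identity`, with y = gk. The
condition gk ≤ 1 - g is exactly what makes the second square's coefficient nonnegative; together
with k < 1 it also gives 2y < 1. -/
theorem displacement_bound_of_ratio {a u w b : H} {s g k : ℝ} (hs : 0 ≤ s) (hsg : s < g)
    (hg : g < 1) (hk : 0 < k) (hk1 : k < 1) (hgk : g * k ≤ 1 - g)
    (hB : 0 ≤ (g - s) * inner ℝ a u + (1 - s) * (inner ℝ a w - (1 - g) * ‖a‖ ^ 2) - ‖w‖ ^ 2 / 4)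
    (hA : 0 ≤ inner ℝ (b - k • (a - u - w)) (a - u - w - b)) :
    k * (1 - g * k) * ‖a + u‖ ^ 2 ≤ inner ℝ (a + u) (a - b) - s * ‖a - b‖ ^ 2 := by
  obtain ⟨y, hy⟩ : ∃ y, y = g * k := ⟨_, rfl⟩
  rw [← hy] at hgk
  have hg0 : 0 < g := hs.trans_lt hsg
  have hy0 : 0 < y := hy ▸ mul_pos hg0 hk
  have hyg : y < g := by rw [hy]; nlinarith
  have h2y : 0 < 1 - 2 * y := by linarith
  have hD : 0 < (1 - 2 * y) * (1 - k) := mul_pos h2y (by linarith)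
  have hE : 0 < 1 - s * (1 + 3 * k - 2 * y - 2 * k * y) := by
    have hgE : g * (1 - s * (1 + 3 * k - 2 * y - 2 * k * y))
        = (g - s) + s * ((1 - g - y) * (1 - 2 * y)) := by
      rw [hy]; ring
    have : 0 < g * (1 - s * (1 + 3 * k - 2 * y - 2 * k * y)) := by
      rw [hgE]
      have := mul_nonneg hs (mul_nonneg (by linarith : 0 ≤ 1 - g - y) h2y.le)
      linarith
    exact pos_of_mul_pos_right this hg0.le
  have hm : 0 ≤ 1 - 4 * (k * (1 - y)) * s := by
    have h1 : k * (1 - y) * s ≤ k * (1 - y) * g :=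
      mul_le_mul_of_nonneg_left hsg.le (mul_nonneg hk.le (by linarith))
    have h2 : k * (1 - y) * g = y * (1 - y) := by rw [hy]; ring
    have h3 : 4 * (y * (1 - y)) = 1 - (1 - 2 * y) ^ 2 := by ring
    linarith [sq_nonneg (1 - 2 * y)]
  have hgs : 0 < g - s := by linarith
  have hk1' : (0 : ℝ) ≤ 4 * (1 - k) := by linarith
  have hgy : 0 ≤ 1 - g - y := by linarith
  have hid := certificate_identity a u w b s g k
  rw [← hy] at hid ⊢
  have hrhs := add_nonneg
    (mul_nonneg hgs.le (sq_nonneg ‖(2 * (1 - s * (1 + 3 * k - 2 * y - 2 * k * y))) • b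
        - ((1 - 2 * y) * (1 - k)) • (a + u - (2 * s) • a)
        - ((1 - 4 * (k * (1 - y)) * s) * (1 + k)) • (a - u - w)‖))
    (mul_nonneg (mul_nonneg (mul_nonneg hk1' hm) hgy)
      (sq_nonneg ‖(k * (g - s)) • u + (1 / 2 - k * s) • w
          - (1 - s - y + 2 * s * y - k * s) • a‖))
  rw [← hid] at hrhs
  have hX := (mul_nonneg_iff_of_pos_left (mul_pos four_pos hE)).1 hrhs
  clear hid hrhs
  have t1 := mul_nonneg (mul_nonneg hD.le hm) hB
  have t2 := mul_nonneg (mul_nonneg hgs.le hm) hA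
  have hfin : 0 ≤ (1 - 2 * y) * (1 - k) * (g - s) *
      (inner ℝ (a + u) (a - b) - s * ‖a - b‖ ^ 2 - k * (1 - y) * ‖a + u‖ ^ 2) := by
    linarith
  have := (mul_nonneg_iff_of_pos_left (mul_pos hD hgs)).1 hfin
  linarith

/-- Lower bound for the displacement when the last operator is `M⁻¹`-cocoercive. -/
theorem displacement_bound {a u w b v : H} {s ν M : ℝ} (hs : 0 ≤ s) (hν : 0 < ν)
    (hsν : s + ν < 1) (hM : 0 < M) (hp : a - u - w = b + v)
    (hB : 0 ≤ (1 - ν - s) * inner ℝ a u + (1 - s) * (inner ℝ a w - ν * ‖a‖ ^ 2) - ‖w‖ ^ 2 / 4)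
    (hA : ‖v‖ ^ 2 ≤ M * inner ℝ b v) :
    min ν ((M + ν) / (1 + M) ^ 2) * ‖a + u‖ ^ 2
      ≤ inner ℝ (a + u) (a - b) - s * ‖a - b‖ ^ 2 := by
  have hbv : 0 ≤ inner ℝ b v := by
    by_contra h
    push Not at h
    nlinarith [mul_neg_of_pos_of_neg hM h, sq_nonneg ‖v‖]
  -- M⁻¹-cocoercivity may be weakened to N⁻¹ for any N ≥ M; the second condition is gk ≤ 1 - g for g
  -- = 1 - ν and k = 1/(1 + N).
  have main : ∀ N : ℝ, M ≤ N → 1 - ν ≤ ν * (1 + N) →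
      (N + ν) / (1 + N) ^ 2 * ‖a + u‖ ^ 2
        ≤ inner ℝ (a + u) (a - b) - s * ‖a - b‖ ^ 2 := by
    intro N hMN hN
    have hN0 : 0 < 1 + N := by linarith
    have hk : (1 + N)⁻¹ * (1 + N) = 1 := inv_mul_cancel₀ hN0.ne'
    have hk0 : 0 < (1 + N)⁻¹ := inv_pos.2 hN0
    set k : ℝ := (1 + N)⁻¹ with hkdef
    have hA' : 0 ≤ inner ℝ (b - k • (a - u - w)) (a - u - w - b) := by
      rw [hp, add_sub_cancel_left]
      have : b - k • (b + v) = k • (N • b - v) := by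
        have : b = (k * (1 + N)) • b := by rw [hk, one_smul]
        nth_rewrite 1 [this]
        module
      rw [this, real_inner_smul_left, inner_sub_left, real_inner_smul_left,
        real_inner_self_eq_norm_sq]
      refine mul_nonneg hk0.le ?_
      nlinarith [mul_le_mul_of_nonneg_right hMN hbv]
    have h := displacement_bound_of_ratio (g := 1 - ν) (k := k) hs (by linarith) (by linarith) hk0
      (inv_lt_one_of_one_lt₀ (by linarith))
      (by
        rw [sub_sub_cancel, hkdef, ← div_eq_mul_inv, div_le_iff₀ hN0]
        exact hN)
      (by rw [sub_sub_cancel]; exact hB) hA'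
    have e : (N + ν) / (1 + N) ^ 2 = k * (1 - (1 - ν) * k) := by
      rw [hkdef]; field_simp; ring
    rw [e]
    exact h
  by_cases hcase : 1 - ν ≤ ν * (1 + M)
  · exact (mul_le_mul_of_nonneg_right (min_le_right _ _) (sq_nonneg _)).trans (main M le_rfl hcase)
  · push Not at hcase
    refine (mul_le_mul_of_nonneg_right (min_le_left _ _) (sq_nonneg _)).trans ?_
    -- When M is too small for the certificate, enlarge it to N = 1/ν - 2, where the condition holds
    -- with equality and (N + ν)/(1 + N)² equals ν.
    have e1 : ν * (1 + (1 / ν - 2)) = 1 - ν := by field_simp; ring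
    have h := main (1 / ν - 2) (by
      have : 1 + M < 1 + (1 / ν - 2) := lt_of_mul_lt_mul_left (by rwa [e1]) hν.le
      linarith) e1.ge
    have hν1 : (1 : ℝ) - ν ≠ 0 := by linarith
    have e2 : (1 / ν - 2 + ν) / (1 + (1 / ν - 2)) ^ 2 = ν := by
      have : 1 + (1 / ν - 2) = (1 - ν) / ν := by field_simp; ring
      rw [this]
      field_simp
      ring
    rwa [e2] at h

/-- Completing the square in 2(1 - s)(a - b) - w. This is nonexpansiveness, used when no modulus is
available: L_f = ∞ or ν = 0. -/
theorem displacement_nonneg {a u w b v : H} {s : ℝ} (hs : s < 1) (hp : a - u - w = b + v)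
    (hB : 0 ≤ inner ℝ a u) (hC : ‖w‖ ^ 2 ≤ 4 * (1 - s) * inner ℝ a w) (hA : 0 ≤ inner ℝ b v) :
    0 ≤ inner ℝ (a + u) (a - b) - s * ‖a - b‖ ^ 2 := by
  have hv : v = a - u - w - b := by rw [hp]; abel
  have hid : 4 * (1 - s) * (inner ℝ (a + u) (a - b) - s * ‖a - b‖ ^ 2)
      = 4 * (1 - s) * inner ℝ a u + 4 * (1 - s) * inner ℝ b v
        + (4 * (1 - s) * inner ℝ a w - ‖w‖ ^ 2) + ‖(2 * (1 - s)) • (a - b) - w‖ ^ 2 := by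
    rw [hv]
    simp only [← real_inner_self_eq_norm_sq, inner_add_left, inner_sub_left,
      inner_sub_right, real_inner_smul_left, real_inner_smul_right,
      real_inner_comm a u, real_inner_comm a w, real_inner_comm a b,
      real_inner_comm u b, real_inner_comm w b]
    ring
  have h4 : 0 < 4 * (1 - s) := by linarith
  rw [← mul_nonneg_iff_of_pos_left h4, hid]
  have t1 := mul_nonneg h4.le hB
  have t2 := mul_nonneg h4.le hA
  nlinarith [sq_nonneg ‖(2 * (1 - s)) • (a - b) - w‖]

theorem norm_sub_smul_le_sqrt {x d : H} {lam τ : ℝ} (hlam : 0 < lam)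
    (h : τ * ‖x‖ ^ 2 ≤ inner ℝ x d - lam / 2 * ‖d‖ ^ 2) :
    ‖x - lam • d‖ ≤ √(1 - 2 * lam * τ) * ‖x‖ := by
  have hsq : ‖x - lam • d‖ ^ 2 ≤ (1 - 2 * lam * τ) * ‖x‖ ^ 2 := by
    rw [norm_sub_sq_real, real_inner_smul_right, norm_smul, mul_pow, Real.norm_eq_abs, sq_abs]
    nlinarith
  rw [← Real.sqrt_sq (norm_nonneg x), ← Real.sqrt_mul' _ (sq_nonneg _)]
  exact Real.le_sqrt_of_sq_le hsq

/-- Displacement bound for the averaged operator when the last operator is such that its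
resolvent takes values in a ball centred at half its argument. -/
theorem norm_averaged_displacement_le {a u w b v : H} {ℓ K : ℝ} (hℓ : 0 < ℓ) (hℓ4 : ℓ < 4)
    (hK : K ≤ 1 / 2) (hp : a - u - w = b + v) (hB : 0 ≤ inner ℝ a u)
    (hC : ‖w‖ ^ 2 ≤ ℓ * inner ℝ a w) (hA : K * ‖b + v‖ ^ 2 ≤ 2 * inner ℝ b v) :
    ‖(2 / (4 - ℓ)) • (a + u) - (a - b)‖
      ≤ √(2 / (4 - ℓ) * (2 / (4 - ℓ) - K)) * ‖a + u‖ := by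
  have h4 : 0 < 4 - ℓ := by linarith
  set θ : ℝ := 2 / (4 - ℓ) with hθ
  have hθpos : 0 < θ := by positivity
  have hθℓ : θ * ℓ = 4 * θ - 2 := by rw [hθ]; field_simp; ring
  set σ : ℝ := √((1 - 2 * K) / 4) with hσ
  have hσ0 : 0 ≤ σ := Real.sqrt_nonneg _
  have hσ2 : σ ^ 2 = (1 - 2 * K) / 4 := Real.sq_sqrt (by linarith)
  -- Since b + v = a - u - w, the vector A does not involve f. The rest, e, is the deviation of b
  -- from the centre of its ball, of radius σ‖b + v‖.
  set A : H := θ • (a + u) - a + (1 / 2 : ℝ) • (b + v) with hAdef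
  set e : H := b - (1 / 2 : ℝ) • (b + v) with hedef
  have hsplit : θ • (a + u) - (a - b) = A + e := by rw [hAdef, hedef]; abel
  have he : ‖e‖ ≤ σ * ‖b + v‖ := by
    refine abs_le_of_sq_le_sq' ?_ (by positivity) |>.2
    rw [mul_pow, hσ2, hedef, norm_sub_sq_real, norm_smul, mul_pow, real_inner_smul_right,
      inner_add_right, real_inner_self_eq_norm_sq]
    rw [norm_add_sq_real] at hA ⊢
    norm_num
    linarith
  have hP : 0 < θ ^ 2 * ℓ / 4 := by positivity
  have hAB : ‖A‖ ^ 2 * (4 / (θ ^ 2 * ℓ)) + ‖b + v‖ ^ 2 / (2 * θ) ≤ ‖a + u‖ ^ 2 := by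
    have hA4 : (4 - ℓ) • A = (ℓ / 2) • (a + u) - ((4 - ℓ) / 2) • w := by
      have e1 : (4 - ℓ) * θ = 2 := by rw [hθ]; field_simp
      have e2 : (4 - ℓ) • A = ((4 - ℓ) * θ) • (a + u) - (4 - ℓ) • a
          + ((4 - ℓ) / 2) • (a - u - w) := by
        rw [hAdef, hp]; module
      rw [e2, e1]; module
    have hid : ℓ * ‖a + u‖ ^ 2 - ‖(4 - ℓ) • A‖ ^ 2 - ℓ * (4 - ℓ) / 4 * ‖b + v‖ ^ 2
        = (4 - ℓ) * (ℓ * inner ℝ a u + (ℓ * inner ℝ a w - ‖w‖ ^ 2)) := by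
      rw [hA4, ← hp]
      simp only [← real_inner_self_eq_norm_sq, inner_add_left, inner_add_right, inner_sub_left,
        inner_sub_right, real_inner_smul_left, real_inner_smul_right,
        real_inner_comm a u, real_inner_comm a w, real_inner_comm u w]
      ring
    have h0 : 0 ≤ (4 - ℓ) * (ℓ * inner ℝ a u + (ℓ * inner ℝ a w - ‖w‖ ^ 2)) :=
      mul_nonneg h4.le (add_nonneg (mul_nonneg hℓ.le hB) (sub_nonneg.2 hC))
    rw [← hid, norm_smul, mul_pow, Real.norm_eq_abs, sq_abs] at h0
    have e3 : ‖A‖ ^ 2 * (4 / (θ ^ 2 * ℓ)) + ‖b + v‖ ^ 2 / (2 * θ)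
        = ((4 - ℓ) ^ 2 * ‖A‖ ^ 2 + ℓ * (4 - ℓ) / 4 * ‖b + v‖ ^ 2) / ℓ := by
      rw [hθ]; field_simp; ring
    rw [e3, div_le_iff₀ hℓ]
    linarith
  have hn : ‖A + e‖ ≤ ‖A‖ + σ * ‖b + v‖ := (norm_add_le _ _).trans (by linarith)
  rw [hsplit]
  refine hn.trans ?_
  rw [← Real.sqrt_sq (norm_nonneg (a + u)), ← Real.sqrt_mul' _ (sq_nonneg _)]
  refine Real.le_sqrt_of_sq_le ?_
  have hPQ : θ * (θ - K) = θ ^ 2 * ℓ / 4 + 2 * θ * σ ^ 2 := by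
    rw [hσ2]; linear_combination (-θ / 4) * hθℓ
  rw [hPQ]
  refine le_trans ?_ (mul_le_mul_of_nonneg_left hAB (by positivity))
  -- Lagrange's identity for Cauchy–Schwarz, with weights θ²ℓ/4 and 2θσ² summing to θ(θ - K).
  have : (θ ^ 2 * ℓ / 4 + 2 * θ * σ ^ 2) *
      (‖A‖ ^ 2 * (4 / (θ ^ 2 * ℓ)) + ‖b + v‖ ^ 2 / (2 * θ)) - (‖A‖ + σ * ‖b + v‖) ^ 2
      = (θ ^ 2 * ℓ / 4 * ‖b + v‖ - 2 * θ * σ * ‖A‖) ^ 2 / (2 * θ * (θ ^ 2 * ℓ / 4)) := by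
    field_simp
    ring
  have h0 : 0 ≤ (θ ^ 2 * ℓ / 4 * ‖b + v‖ - 2 * θ * σ * ‖A‖) ^ 2 / (2 * θ * (θ ^ 2 * ℓ / 4)) := by
    positivity
  linarith

end Certificates

/-! ### Consequences of the interpolation inequality. -/

section Disc

variable {H : Type*} [NormedAddCommGroup H] [InnerProductSpace ℝ H]

/-- Adding ‖e - μd‖² or ‖Ld - e‖² to the hypothesis gives the first two bounds multiplied by L - μ;
the third is its expansion. -/
theorem le_inner_of_disc {d e : H} {μ L : ℝ} (hμL : μ < L)
    (h : 0 ≤ inner ℝ (L • d - e) (e - μ • d)) :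
    μ * ‖d‖ ^ 2 ≤ inner ℝ d e ∧ inner ℝ d e ≤ L * ‖d‖ ^ 2 ∧
      ‖e‖ ^ 2 ≤ (L + μ) * inner ℝ d e - L * μ * ‖d‖ ^ 2 := by
  have h1 := sq_nonneg ‖e - μ • d‖
  have h2 := sq_nonneg ‖L • d - e‖
  simp only [← real_inner_self_eq_norm_sq, inner_sub_left, inner_sub_right, real_inner_smul_left,
    real_inner_smul_right, real_inner_comm d e] at h h1 h2 ⊢
  have hpos : 0 < L - μ := sub_pos.2 hμL
  refine ⟨le_of_mul_le_mul_left ?_ hpos, le_of_mul_le_mul_left ?_ hpos, ?_⟩ <;> linarith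

theorem two_mul_div_one_add_sq_le {α t : ℝ} (hα : 0 < α) (ht : 0 ≤ t) :
    α * (2 * t / (1 + α * t) ^ 2) ≤ 1 / 2 := by
  have : 0 < (1 + α * t) ^ 2 := by positivity
  rw [← mul_div_assoc, div_le_iff₀ this]
  nlinarith [sq_nonneg (1 - α * t)]

/-- The resolvent of an operator whose graph differences lie in the disc over `[μ, L]`. -/
theorem reflected_bound_of_disc {d e : H} {μ L α : ℝ} (hα : 0 < α) (hμ : 0 ≤ μ) (hμL : μ < L)
    (h : 0 ≤ inner ℝ (L • d - e) (e - μ • d)) :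
    α * min (2 * μ / (1 + α * μ) ^ 2) (2 * L / (1 + α * L) ^ 2) * ‖d + α • e‖ ^ 2
      ≤ 2 * inner ℝ d (α • e) := by
  obtain ⟨h1, h2, h3⟩ := le_inner_of_disc hμL h
  have hn : ‖d + α • e‖ ^ 2 = ‖d‖ ^ 2 + 2 * (α * inner ℝ d e) + α ^ 2 * ‖e‖ ^ 2 := by
    rw [norm_add_sq_real, real_inner_smul_right, norm_smul, mul_pow, Real.norm_eq_abs, sq_abs]
  have key : ∀ t : ℝ, 0 ≤ t → t * (‖d‖ ^ 2 + α ^ 2 * ‖e‖ ^ 2)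
        ≤ (1 + α ^ 2 * t ^ 2) * inner ℝ d e →
      α * (2 * t / (1 + α * t) ^ 2) * ‖d + α • e‖ ^ 2 ≤ 2 * inner ℝ d (α • e) := by
    intro t ht hle
    have hden : 0 < (1 + α * t) ^ 2 := by positivity
    have e1 : α * (2 * t / (1 + α * t) ^ 2) * ‖d + α • e‖ ^ 2
        = 2 * α * (t * ‖d + α • e‖ ^ 2) / (1 + α * t) ^ 2 := by ring
    rw [e1, div_le_iff₀ hden, hn, real_inner_smul_right]
    have := mul_le_mul_of_nonneg_left hle (by positivity : 0 ≤ 2 * α)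
    linarith
  have hL : 0 < L := hμ.trans_lt hμL
  have hα2 : 0 ≤ α ^ 2 := sq_nonneg α
  -- The map t ↦ t/(1 + αt)² is invariant under αt ↦ 1/(αt), so this comparison decides which
  -- endpoint attains the minimum.
  rcases le_total (α ^ 2 * (L * μ)) 1 with hc | hc
  · refine le_trans ?_ (key μ hμ ?_)
    · gcongr
      exact min_le_left _ _
    · have t1 := mul_le_mul_of_nonneg_left h3 (mul_nonneg hμ hα2)
      have t2 := mul_le_mul_of_nonneg_left h1 (sub_nonneg.2 hc)
      linarith
  · refine le_trans ?_ (key L hL.le ?_)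
    · gcongr
      exact min_le_right _ _
    · have t1 := mul_le_mul_of_nonneg_left h3 (mul_nonneg hL.le hα2)
      have t2 := mul_le_mul_of_nonneg_left h2 (sub_nonneg.2 hc)
      linarith

/-- Eliminating ‖e‖² through the disc leaves an expression affine in ⟨d, e⟩, which lies between
μ‖d‖² and L‖d‖². The sign of its slope 1 - β(L + μ) selects the endpoint. -/
theorem inner_sub_norm_sq_ge_of_disc {d e : H} {μ L β : ℝ} (hβ : 0 ≤ β) (hμL : μ < L)
    (h : 0 ≤ inner ℝ (L • d - e) (e - μ • d)) :
    min (μ * (1 - β * μ)) (L * (1 - β * L)) * ‖d‖ ^ 2 ≤ inner ℝ d e - β * ‖e‖ ^ 2 := by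
  obtain ⟨h1, h2, h3⟩ := le_inner_of_disc hμL h
  have t1 := mul_le_mul_of_nonneg_left h3 hβ
  rcases le_total (β * (L + μ)) 1 with hc | hc
  · refine (mul_le_mul_of_nonneg_right (min_le_left _ _) (sq_nonneg _)).trans ?_
    have t2 := mul_le_mul_of_nonneg_left h1 (sub_nonneg.2 hc)
    linarith
  · refine (mul_le_mul_of_nonneg_right (min_le_right _ _) (sq_nonneg _)).trans ?_
    have t2 := mul_le_mul_of_nonneg_left h2 (sub_nonneg.2 hc)
    linarith

end Disc

/-! ### Contractivity with the new factors. -/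

section FunClass

variable {H : Type*} [NormedAddCommGroup H] [InnerProductSpace ℝ H] [CompleteSpace H]

theorem FunClass.monotone {μ : ℝ} {L : EReal} {f : H → EReal} (hf : FunClass μ L f) {x y u v : H}
    (hu : u ∈ subdiff f x) (hv : v ∈ subdiff f y) : 0 ≤ inner ℝ (x - y) (u - v) := by
  have h := subdiff_strongly_monotone hf.ccp (le_max_left 0 (0 : ℝ))
    (fun h => absurd h (by simp)) hu hv
  simpa using h

theorem FunClass.disc {μ L : ℝ} {f : H → EReal} (hf : FunClass μ (L : EReal) f) (hμ : 0 ≤ μ)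
    (hμL : μ < L) {x y u v : H} (hu : u ∈ subdiff f x) (hv : v ∈ subdiff f y) :
    0 ≤ inner ℝ (L • (x - y) - (u - v)) ((u - v) - μ • (x - y)) :=
  subdiff_interpolation hμ hμL hf.strong
    (by simpa using hf.smooth (EReal.coe_ne_top L)) hu hv

theorem FunClass.cocoercive {μ L : ℝ} {f : H → EReal} (hf : FunClass μ (L : EReal) f)
    (hL : 0 < L) {x y u v : H} (hu : u ∈ subdiff f x) (hv : v ∈ subdiff f y) :
    ‖u - v‖ ^ 2 ≤ L * inner ℝ (x - y) (u - v) := by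
  have h := subdiff_interpolation le_rfl hL (fun h => absurd h (lt_irrefl 0))
    (by simpa using hf.smooth (EReal.coe_ne_top L)) hu hv
  rw [zero_smul, sub_zero, inner_sub_left, real_inner_smul_left, real_inner_self_eq_norm_sq] at h
  linarith

theorem FunClass.cocoercive_smul {μ L α : ℝ} {f : H → EReal} (hf : FunClass μ (L : EReal) f)
    (hL : 0 < L) {x y u v : H} (hu : u ∈ subdiff f x) (hv : v ∈ subdiff f y) :
    ‖α • (u - v)‖ ^ 2 ≤ α * L * inner ℝ (x - y) (α • (u - v)) := by
  rw [norm_smul, mul_pow, Real.norm_eq_abs, sq_abs, real_inner_smul_right]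
  have := mul_le_mul_of_nonneg_left (hf.cocoercive hL hu hv) (sq_nonneg α)
  linarith

theorem quotAt_top (q : ℝ → ℝ) : quotAt q ⊤ = 0 := by simp [quotAt]

theorem quotAt_coe (q : ℝ → ℝ) (L : ℝ) : quotAt q (L : EReal) = q L := by simp [quotAt]

/-- Contractivity when `f` is strongly convex and smooth. -/
theorem isContractive_rhoNewF {α lam Lh : ℝ} (hα : 0 < α) (hlam : 0 < lam) (hLh : 0 < Lh)
    (hαLh : α * Lh < 4) (hlam_lt : lam < 2 - α * Lh / 2) {μf μg μh : ℝ} {Lf Lg : EReal}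
    (hμf : 0 ≤ μf) (hμL : (μf : EReal) < Lf) {f g h : H → EReal} (hf : FunClass μf Lf f)
    (hg : FunClass μg Lg g) (hh : FunClass μh (Lh : EReal) h) :
    MultiOp.IsContractive (rhoNewF α lam μf Lf Lh)
      (MultiOp.davisYin (subdiff f) (subdiff g) (subdiff h) α lam) := by
  refine isContractive_davisYin hα hg.monotone ?_
  intro a a' u u' w w' b b' v v' hu hu' hw hw' hv hv' hp
  have h4 : 0 < 4 - α * Lh := by linarith
  have hA : α * min (2 * μf / (1 + α * μf) ^ 2)
        (quotAt (fun L => 2 * L / (1 + α * L) ^ 2) Lf) * ‖(b - b') + α • (v - v')‖ ^ 2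
      ≤ 2 * inner ℝ (b - b') (α • (v - v')) := by
    induction Lf with
    | bot => exact absurd hμL not_lt_bot
    | top =>
      rw [quotAt_top, min_eq_right (by positivity), mul_zero, zero_mul]
      exact mul_nonneg zero_le_two (real_inner_smul_right (b - b') (v - v') α ▸
        mul_nonneg hα.le (hf.monotone hv hv'))
    | coe L =>
      rw [quotAt_coe]
      have hL : μf < L := by exact_mod_cast hμL
      exact reflected_bound_of_disc hα hμf hL (hf.disc hμf hL hv hv')
  have key := norm_averaged_displacement_le (mul_pos hα hLh) hαLh
    ((mul_le_mul_of_nonneg_left (min_le_left _ _) hα.le).trans (two_mul_div_one_add_sq_le hα hμf)) hp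
    (real_inner_smul_right (a - a') (u - u') α ▸ mul_nonneg hα.le (hg.monotone hu hu'))
    (hh.cocoercive_smul (α := α) hLh hw hw') hA
  set x := (a - a') + α • (u - u')
  set d := (a - a') - (b - b')
  set S := √(2 / (4 - α * Lh) * (2 / (4 - α * Lh) - α * min (2 * μf / (1 + α * μf) ^ 2)
        (quotAt (fun L => 2 * L / (1 + α * L) ^ 2) Lf))) with hS
  -- Averaging with θ = 2/(4 - αL_h); the condition on λ makes the weight 1 - λθ nonnegative.
  have hsplit : x - lam • d
      = (1 - 2 * lam / (4 - α * Lh)) • x + lam • ((2 / (4 - α * Lh)) • x - d) := by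
    module
  have hnn : 0 ≤ 1 - 2 * lam / (4 - α * Lh) := by
    rw [sub_nonneg, div_le_one h4]
    linarith
  have hrho : rhoNewF α lam μf Lf Lh = 1 - 2 * lam / (4 - α * Lh) + lam * S := rfl
  calc ‖x - lam • d‖ ≤ (1 - 2 * lam / (4 - α * Lh)) * ‖x‖
        + lam * ‖(2 / (4 - α * Lh)) • x - d‖ := by
        rw [hsplit]
        refine (norm_add_le _ _).trans (le_of_eq ?_)
        rw [norm_smul, norm_smul, Real.norm_of_nonneg hnn, Real.norm_of_nonneg hlam.le]
    _ ≤ (1 - 2 * lam / (4 - α * Lh)) * ‖x‖ + lam * (S * ‖x‖) := by gcongr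
    _ = _ := by rw [hrho]; ring

/-- Contractivity when `f` is smooth, from a joint lower bound for `g` and `h`. -/
theorem isContractive_of_joint_bound {α lam Lh ν : ℝ} (hα : 0 < α) (hlam : 0 < lam) (hLh : 0 < Lh)
    (hlam_lt : lam < 2 - α * Lh / 2) (hν : 0 ≤ ν) (hν2 : lam / 2 + α * ν < 1)
    {μf μg μh : ℝ} {Lf Lg : EReal} (hLf : 0 < Lf) {f g h : H → EReal} (hf : FunClass μf Lf f)
    (hg : FunClass μg Lg g) (hh : FunClass μh (Lh : EReal) h)
    (hgh : ∀ {a a' u u' w w' : H}, u ∈ subdiff g a → u' ∈ subdiff g a' → w ∈ subdiff h a →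
      w' ∈ subdiff h a' →
      0 ≤ (1 - α * ν - lam / 2) * inner ℝ (a - a') (α • (u - u'))
        + (1 - lam / 2) * (inner ℝ (a - a') (α • (w - w')) - α * ν * ‖a - a'‖ ^ 2)
        - ‖α • (w - w')‖ ^ 2 / 4) :
    MultiOp.IsContractive
      (√(1 - 2 * lam * α * min ν (quotAt (fun L => (L + ν) / (1 + α * L) ^ 2) Lf)))
      (MultiOp.davisYin (subdiff f) (subdiff g) (subdiff h) α lam) := by
  refine isContractive_davisYin hα hg.monotone ?_
  intro a a' u u' w w' b b' v v' hu hu' hw hw' hv hv' hp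
  rw [mul_assoc (2 * lam)]
  refine norm_sub_smul_le_sqrt hlam ?_
  have hαν : 0 ≤ α * ν := mul_nonneg hα.le hν
  have htriv : 0 ≤ inner ℝ ((a - a') + α • (u - u')) ((a - a') - (b - b'))
      - lam / 2 * ‖(a - a') - (b - b')‖ ^ 2 := by
    have hw0 : 0 ≤ inner ℝ (a - a') (α • (w - w')) :=
      real_inner_smul_right (a - a') (w - w') α ▸ mul_nonneg hα.le (hh.monotone hw hw')
    refine displacement_nonneg (by linarith) hp
      (real_inner_smul_right (a - a') (u - u') α ▸ mul_nonneg hα.le (hg.monotone hu hu'))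
      ((hh.cocoercive_smul (α := α) hLh hw hw').trans ?_)
      (real_inner_smul_right (b - b') (v - v') α ▸ mul_nonneg hα.le (hf.monotone hv hv'))
    exact mul_le_mul_of_nonneg_right (by linarith) hw0
  induction Lf with
  | bot => exact absurd hLf not_lt_bot
  | top =>
    rw [quotAt_top, min_eq_right hν, mul_zero, zero_mul]
    exact htriv
  | coe L =>
    have hL : 0 < L := by exact_mod_cast hLf
    rw [quotAt_coe]
    rcases hν.eq_or_lt with rfl | hνpos
    · rw [min_eq_left (by positivity), mul_zero, zero_mul]
      exact htriv
    · have h := displacement_bound (s := lam / 2) (by positivity) (mul_pos hα hνpos) hν2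
        (mul_pos hα hL) hp (hgh hu hu' hw hw') (hf.cocoercive_smul (α := α) hL hv hv')
      rw [mul_min_of_nonneg _ _ hα.le]
      have e : α * ((L + ν) / (1 + α * L) ^ 2) = (α * L + α * ν) / (1 + α * L) ^ 2 := by ring
      rw [e]
      exact h

/-- The modulus `(2 - lam) μg / (2 - lam + 2 α μg)` occurring in the factor `rhoNewG`. -/
noncomputable def nuG (α lam μg : ℝ) : ℝ := (2 - lam) * μg / (2 - lam + 2 * α * μg)

/-- Rewriting q as (L + ν)/(1 + αL)² puts the factor in the form produced by
`isContractive_of_joint_bound`. -/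
theorem rhoNewG_eq {α lam μg : ℝ} (hα : 0 < α) (hlam : lam < 2) (hμg : 0 ≤ μg) (Lf : EReal) :
    rhoNewG α lam μg Lf = √(1 - 2 * lam * α * min (nuG α lam μg)
      (quotAt (fun L => (L + nuG α lam μg) / (1 + α * L) ^ 2) Lf)) := by
  have hden : 2 - lam + 2 * α * μg ≠ 0 := by
    have : 0 ≤ 2 * α * μg := by positivity
    linarith
  have : (fun L : ℝ => ((2 - lam) * (μg + L) + 2 * α * μg * L) /
      ((1 + α * L) ^ 2 * (2 - lam + 2 * α * μg)))
      = fun L => (L + nuG α lam μg) / (1 + α * L) ^ 2 := by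
    funext L
    rw [mul_comm ((1 + α * L) ^ 2), ← div_div, nuG]
    congr 1
    rw [div_eq_iff hden, add_mul, div_mul_cancel₀ _ hden]
    ring
  rw [rhoNewG, this, nuG]

/-- Contractivity when `g` is strongly convex and `f` is smooth. -/
theorem isContractive_rhoNewG {α lam Lh : ℝ} (hα : 0 < α) (hlam : 0 < lam) (hLh : 0 < Lh)
    (hlam_lt : lam < 2 - α * Lh / 2) {μf μg μh : ℝ} {Lf Lg : EReal}
    (hμg : 0 ≤ μg) (hLf : 0 < Lf) {f g h : H → EReal} (hf : FunClass μf Lf f)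
    (hg : FunClass μg Lg g) (hh : FunClass μh (Lh : EReal) h) :
    MultiOp.IsContractive (rhoNewG α lam μg Lf)
      (MultiOp.davisYin (subdiff f) (subdiff g) (subdiff h) α lam) := by
  have hαLh : 0 < α * Lh := mul_pos hα hLh
  have hκ : 0 < 2 - lam := by linarith
  have hαμ : 0 ≤ α * μg := mul_nonneg hα.le hμg
  have hden : 0 < 2 - lam + 2 * α * μg := by linarith
  rw [rhoNewG_eq hα (by linarith) hμg]
  have hν : α * nuG α lam μg * (2 - lam + 2 * α * μg) = (2 - lam) * (α * μg) := by
    rw [nuG]; field_simp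
  have hgap : (1 - α * nuG α lam μg - lam / 2) * (2 - lam + 2 * α * μg) = (2 - lam) ^ 2 / 2 := by
    linear_combination -hν
  have hgap0 : 0 < 1 - α * nuG α lam μg - lam / 2 :=
    pos_of_mul_pos_left (hgap ▸ by positivity) hden.le
  refine isContractive_of_joint_bound hα hlam hLh hlam_lt ?_ (by linarith) hLf hf hg hh ?_
  · rw [nuG]; positivity
  intro a a' u u' w w' hu hu' hw hw'
  have h1 := subdiff_strongly_monotone hg.ccp hμg hg.strong hu hu'
  have hw0 : 0 ≤ inner ℝ (a - a') (α • (w - w')) :=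
    real_inner_smul_right (a - a') (w - w') α ▸ mul_nonneg hα.le (hh.monotone hw hw')
  have h2 := hh.cocoercive_smul (α := α) hLh hw hw'
  have h3 : α * Lh * inner ℝ (a - a') (α • (w - w'))
      ≤ 4 * (1 - lam / 2) * inner ℝ (a - a') (α • (w - w')) :=
    mul_le_mul_of_nonneg_right (by linarith) hw0
  -- This equation determines ν: the strong monotonicity of g exactly pays for the term in ‖a -
  -- a'‖², while cocoercivity of h pays for the term in ‖w - w'‖².
  have h4 : (1 - α * nuG α lam μg - lam / 2) * (α * μg) = (1 - lam / 2) * (α * nuG α lam μg) := by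
    linear_combination -hν / 2
  have h5 := mul_le_mul_of_nonneg_left h1 (mul_nonneg hgap0.le hα.le)
  rw [real_inner_smul_right (a - a') (u - u')]
  have h6 : (1 - α * nuG α lam μg - lam / 2) * α * (μg * ‖a - a'‖ ^ 2)
      = (1 - lam / 2) * (α * nuG α lam μg) * ‖a - a'‖ ^ 2 := by rw [← h4]; ring
  linarith

/-- Contractivity when `h` is strongly convex and `f` is smooth. -/
theorem isContractive_rhoNewH {α lam Lh : ℝ} (hα : 0 < α) (hlam : 0 < lam) (hLh : 0 < Lh)
    (hlam_lt : lam < 2 - α * Lh / 2) {μf μg μh : ℝ} {Lf Lg : EReal}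
    (hμh : 0 ≤ μh) (hμL : μh < Lh) (hLf : 0 < Lf) {f g h : H → EReal} (hf : FunClass μf Lf f)
    (hg : FunClass μg Lg g) (hh : FunClass μh (Lh : EReal) h) (hξ : 0 ≤ xiH α lam μh Lh)
    (hξ' : lam / 2 + α * xiH α lam μh Lh < 1) :
    MultiOp.IsContractive (rhoNewH α lam Lf μh Lh)
      (MultiOp.davisYin (subdiff f) (subdiff g) (subdiff h) α lam) := by
  have hαLh : 0 < α * Lh := mul_pos hα hLh
  have hκ : 0 < 2 - lam := by linarith
  refine isContractive_of_joint_bound hα hlam hLh hlam_lt hξ hξ' hLf hf hg hh ?_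
  intro a a' u u' w w' hu hu' hw hw'
  -- This β satisfies (1 - λ/2)αβ = α²/4, matching the quarter of a square in the joint bound; g
  -- contributes only monotonicity.
  have h1 := inner_sub_norm_sq_ge_of_disc (β := α / (2 * (2 - lam))) (by positivity) hμL
    (hh.disc hμh hμL hw hw')
  have e1 : min (μh * (1 - α / (2 * (2 - lam)) * μh)) (Lh * (1 - α / (2 * (2 - lam)) * Lh))
      = xiH α lam μh Lh := by
    rw [xiH, div_mul_eq_mul_div, div_mul_eq_mul_div]
  rw [e1] at h1
  have hs : 0 ≤ 1 - lam / 2 := by linarith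
  have h2 := mul_le_mul_of_nonneg_left h1 (mul_nonneg hs hα.le)
  have e2 : (1 - lam / 2) * α * (α / (2 * (2 - lam)) * ‖w - w'‖ ^ 2)
      = α ^ 2 * ‖w - w'‖ ^ 2 / 4 := by
    have : 2 - lam ≠ 0 := hκ.ne'
    field_simp
    ring
  have h3 : 0 ≤ (1 - α * xiH α lam μh Lh - lam / 2) * inner ℝ (a - a') (α • (u - u')) :=
    mul_nonneg (by linarith)
      (real_inner_smul_right (a - a') (u - u') α ▸ mul_nonneg hα.le (hg.monotone hu hu'))
  rw [real_inner_smul_right (a - a') (w - w'), norm_smul, mul_pow, Real.norm_eq_abs, sq_abs]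
  linarith

end FunClass

/-! ### Comparison of the old and new factors. -/

section Factors

theorem MultiOp.IsContractive.mono {H : Type*} [NormedAddCommGroup H] [InnerProductSpace ℝ H]
    {ρ ρ' : ℝ} {T : MultiOp H} (h : MultiOp.IsContractive ρ T) (hle : ρ ≤ ρ') :
    MultiOp.IsContractive ρ' T :=
  fun x y u hu v hv => (h x y u hu v hv).trans (mul_le_mul_of_nonneg_right hle (norm_nonneg _))

/-- After cross-multiplication the differences are 2α³μ(L² - μ²) and 2α(L - μ)(1 + α²L²). -/
theorem quot_oldF_le {α μ L : ℝ} (hα : 0 < α) (hμ : 0 ≤ μ) (hμL : μ < L) :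
    2 * α * μ / (α ^ 2 * L ^ 2 + 2 * α * μ + 1)
      ≤ α * min (2 * μ / (1 + α * μ) ^ 2) (2 * L / (1 + α * L) ^ 2) := by
  have hL : 0 < L := hμ.trans_lt hμL
  have hα2 : 0 < α ^ 2 := by positivity
  rw [mul_min_of_nonneg _ _ hα.le, ← mul_div_assoc, ← mul_div_assoc]
  refine le_min ?_ ?_
  · rw [div_le_div_iff₀ (by positivity) (by positivity)]
    have h1 : μ ^ 2 ≤ L ^ 2 := by gcongr
    have h2 := mul_le_mul_of_nonneg_left h1 (by positivity : 0 ≤ 2 * α * μ * α ^ 2)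
    linarith
  · rw [div_le_div_iff₀ (by positivity) (by positivity)]
    have h1 : 0 ≤ 2 * α * ((L - μ) * (1 + α ^ 2 * L ^ 2)) := by
      have := sub_pos.2 hμL
      positivity
    linarith

theorem quot_oldF_lt {α μ L : ℝ} (hα : 0 < α) (hμ : 0 < μ) (hμL : μ < L) :
    2 * α * μ / (α ^ 2 * L ^ 2 + 2 * α * μ + 1)
      < α * min (2 * μ / (1 + α * μ) ^ 2) (2 * L / (1 + α * L) ^ 2) := by
  have hL : 0 < L := hμ.trans hμL
  have hα2 : 0 < α ^ 2 := by positivity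
  rw [mul_min_of_nonneg _ _ hα.le, ← mul_div_assoc, ← mul_div_assoc]
  refine lt_min ?_ ?_
  · rw [div_lt_div_iff₀ (by positivity) (by positivity)]
    have h1 : μ ^ 2 < L ^ 2 := by gcongr
    have h2 := mul_lt_mul_of_pos_left h1 (by positivity : 0 < 2 * α * μ * α ^ 2)
    linarith
  · rw [div_lt_div_iff₀ (by positivity) (by positivity)]
    have h1 : 0 < 2 * α * ((L - μ) * (1 + α ^ 2 * L ^ 2)) := by
      have := sub_pos.2 hμL
      positivity
    linarith

theorem rhoNewF_le_rhoOldF {α lam Lh μf : ℝ} {Lf : EReal} (hα : 0 < α) (hlam : 0 < lam)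
    (hαLh : α * Lh < 4) (hμf : 0 ≤ μf) (hμL : (μf : EReal) < Lf) :
    rhoNewF α lam μf Lf Lh ≤ rhoOldF α lam μf Lf Lh := by
  have h4 : 0 < 4 - α * Lh := by linarith
  have key : quotAt (fun L => 2 * α * μf / (α ^ 2 * L ^ 2 + 2 * α * μf + 1)) Lf
      ≤ α * min (2 * μf / (1 + α * μf) ^ 2) (quotAt (fun L => 2 * L / (1 + α * L) ^ 2) Lf) := by
    induction Lf with
    | bot => exact absurd hμL not_lt_bot
    | top =>
      rw [quotAt_top, quotAt_top]
      exact mul_nonneg hα.le (le_min (by positivity) le_rfl)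
    | coe L =>
      rw [quotAt_coe, quotAt_coe]
      exact quot_oldF_le hα hμf (by exact_mod_cast hμL)
  unfold rhoNewF rhoOldF
  gcongr

theorem rhoNewF_lt_rhoOldF {α lam Lh μf L : ℝ} (hα : 0 < α) (hlam : 0 < lam) (hLh : 0 < Lh)
    (hαLh : α * Lh < 4) (hμf : 0 < μf) (hμL : μf < L) :
    rhoNewF α lam μf L Lh < rhoOldF α lam μf L Lh ∧ rhoOldF α lam μf L Lh < 1 := by
  have h4 : 0 < 4 - α * Lh := by linarith
  have hθ : 1 / 2 < 2 / (4 - α * Lh) := by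
    rw [div_lt_div_iff₀ two_pos h4]
    linarith [mul_pos hα hLh]
  have hθ0 : 0 < 2 / (4 - α * Lh) := by linarith
  have hlt := quot_oldF_lt hα hμf hμL
  have hle := (mul_le_mul_of_nonneg_left (min_le_left (2 * μf / (1 + α * μf) ^ 2)
    (2 * L / (1 + α * L) ^ 2)) hα.le).trans (two_mul_div_one_add_sq_le hα hμf.le)
  have hpos : 0 < 2 * α * μf / (α ^ 2 * L ^ 2 + 2 * α * μf + 1) := by positivity
  unfold rhoNewF rhoOldF
  rw [quotAt_coe, quotAt_coe]
  set q := 2 * α * μf / (α ^ 2 * L ^ 2 + 2 * α * μf + 1)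
  set K := α * min (2 * μf / (1 + α * μf) ^ 2) (2 * L / (1 + α * L) ^ 2)
  have e : 2 * lam / (4 - α * Lh) = lam * (2 / (4 - α * Lh)) := by ring
  rw [e]
  set θ := 2 / (4 - α * Lh)
  constructor
  · have := Real.sqrt_lt_sqrt (mul_nonneg hθ0.le (by linarith))
      (mul_lt_mul_of_pos_left (by linarith : θ - K < θ - q) hθ0)
    linarith [mul_lt_mul_of_pos_left this hlam]
  · have : √(θ * (θ - q)) < θ := by
      rw [Real.sqrt_lt' hθ0, sq]
      exact mul_lt_mul_of_pos_left (by linarith) hθ0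
    linarith [mul_lt_mul_of_pos_left this hlam]

theorem rhoNewF_eq_rhoOldF {α lam Lh : ℝ} {Lf : EReal} (hα : 0 < α) (hLf : 0 < Lf) :
    rhoNewF α lam 0 Lf Lh = rhoOldF α lam 0 Lf Lh := by
  have h1 : quotAt (fun L => 2 * α * 0 / (α ^ 2 * L ^ 2 + 2 * α * 0 + 1)) Lf = 0 := by
    simp [quotAt]
  have h2 : min (2 * 0 / (1 + α * 0) ^ 2) (quotAt (fun L => 2 * L / (1 + α * L) ^ 2) Lf) = 0 := by
    rw [mul_zero, zero_div]
    refine min_eq_left ?_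
    induction Lf with
    | bot => exact absurd hLf not_lt_bot
    | top => rw [quotAt_top]
    | coe L =>
      rw [quotAt_coe]
      have : 0 < L := by exact_mod_cast hLf
      positivity
  rw [rhoNewF, rhoOldF, h1, h2, mul_zero]

theorem sqrt_factor_le {lam α x y : ℝ} (hα : 0 < α) (hlam : 0 < lam) (h : x ≤ y) :
    √(1 - 2 * lam * α * y) ≤ √(1 - 2 * lam * α * x) := by
  gcongr

theorem sqrt_factor_lt {lam α x y : ℝ} (hα : 0 < α) (hlam : 0 < lam) (h : x < y)
    (hy : lam / 2 + α * y ≤ 1) : √(1 - 2 * lam * α * y) < √(1 - 2 * lam * α * x) := by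
  have h1 := mul_lt_mul_of_pos_left h (by positivity : 0 < 2 * lam * α)
  refine Real.sqrt_lt_sqrt ?_ (by linarith)
  -- The radicand is at least 1 - 2λ(1 - λ/2) = (1 - λ)², so the square root is not truncated and
  -- strictness survives.
  nlinarith [mul_le_mul_of_nonneg_left hy hlam.le, sq_nonneg (lam - 1)]

theorem sqrt_factor_lt_one {lam α x : ℝ} (hα : 0 < α) (hlam : 0 < lam) (h : 0 < x) :
    √(1 - 2 * lam * α * x) < 1 := by
  rw [Real.sqrt_lt' one_pos]
  have : 0 < 2 * lam * α * x := by positivity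
  linarith

theorem rhoNewG_le_rhoOldG {α lam μg : ℝ} {Lf : EReal} (hα : 0 < α) (hlam : 0 < lam)
    (hlam2 : lam < 2) (hμg : 0 ≤ μg) :
    rhoNewG α lam μg Lf ≤ rhoOldG α lam μg Lf := by
  have hκ : 0 < 2 - lam := by linarith
  refine sqrt_factor_le hα hlam (min_le_min_right _ ?_)
  unfold quotAt
  split_ifs
  · positivity
  · refine div_le_div_of_nonneg_left (by positivity) (by positivity) ?_
    refine le_mul_of_one_le_left (by positivity) ?_
    have : 0 ≤ α ^ 2 * Lf.toReal ^ 2 := by positivity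
    linarith

theorem rhoOldG_lt_one {α lam μg L : ℝ} (hα : 0 < α) (hlam : 0 < lam)
    (hlam2 : lam < 2) (hμg : 0 < μg) (hL : 0 < L) : rhoOldG α lam μg L < 1 := by
  have hκ : 0 < 2 - lam := by linarith
  unfold rhoOldG
  rw [quotAt_coe, quotAt_coe]
  exact sqrt_factor_lt_one hα hlam (lt_min (by positivity) (by positivity))

theorem rhoNewG_lt_rhoOldG {α lam μg L : ℝ} (hα : 0 < α) (hlam : 0 < lam)
    (hlam2 : lam < 2) (hμg : 0 < μg) (hL : 0 < L)
    (h : 0 < (2 - lam) * (1 - 2 * α * μg + α ^ 2 * L ^ 2) + 2 * α * μg * (1 + α ^ 2 * L ^ 2)) :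
    rhoNewG α lam μg L < rhoOldG α lam μg L := by
  have hκ : 0 < 2 - lam := by linarith
  have hden : 0 < 2 - lam + 2 * α * μg := by positivity
  unfold rhoNewG rhoOldG
  rw [quotAt_coe, quotAt_coe]
  have h1 : (2 - lam) * μg / ((1 + α ^ 2 * L ^ 2) * (2 - lam + 2 * α * μg))
      < (2 - lam) * μg / (2 - lam + 2 * α * μg) := by
    refine div_lt_div_of_pos_left (by positivity) hden ?_
    refine lt_mul_of_one_lt_left hden ?_
    have : 0 < α ^ 2 * L ^ 2 := by positivity
    linarith
  have h2 : (2 - lam) * μg / ((1 + α ^ 2 * L ^ 2) * (2 - lam + 2 * α * μg))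
      < ((2 - lam) * (μg + L) + 2 * α * μg * L) / ((1 + α * L) ^ 2 * (2 - lam + 2 * α * μg)) := by
    rw [← div_div, ← div_div]
    refine div_lt_div_of_pos_right ?_ hden
    rw [div_lt_div_iff₀ (by positivity) (by positivity)]
    -- The cross-multiplied difference is L times the assumed positive quantity, so the assumption
    -- says exactly that q exceeds the old first term.
    linarith [mul_pos hL h]
  refine sqrt_factor_lt hα hlam ((min_le_left _ _).trans_lt (lt_min h1 h2)) ?_
  have h3 : α * ((2 - lam) * μg / (2 - lam + 2 * α * μg)) ≤ (2 - lam) / 2 := by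
    rw [← mul_div_assoc, div_le_div_iff₀ hden two_pos]
    linarith [mul_pos hκ hκ]
  have h4 := mul_le_mul_of_nonneg_left (min_le_left ((2 - lam) * μg / (2 - lam + 2 * α * μg))
    (((2 - lam) * (μg + L) + 2 * α * μg * L) / ((1 + α * L) ^ 2 * (2 - lam + 2 * α * μg)))) hα.le
  linarith

theorem one_sub_div_pos {α lam Lh : ℝ} (hlam : lam < 2) (hlam_lt : lam < 2 - α * Lh / 2) :
    0 < 1 - α * Lh / (2 * (2 - lam)) := by
  rw [sub_pos, div_lt_one (by linarith)]
  linarith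

theorem modulus_le_xiH {α lam μh Lh : ℝ} (hα : 0 < α) (hlam : lam < 2)
    (hlam_lt : lam < 2 - α * Lh / 2) (hμh : 0 ≤ μh) (hμL : μh < Lh) :
    μh * (1 - α * Lh / (2 * (2 - lam))) ≤ xiH α lam μh Lh := by
  have hκ : 0 < 2 - lam := by linarith
  have := one_sub_div_pos hlam hlam_lt
  refine le_min ?_ ?_ <;> gcongr

theorem modulus_lt_xiH {α lam μh Lh : ℝ} (hα : 0 < α) (hlam : lam < 2)
    (hlam_lt : lam < 2 - α * Lh / 2) (hμh : 0 < μh) (hμL : μh < Lh) :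
    μh * (1 - α * Lh / (2 * (2 - lam))) < xiH α lam μh Lh := by
  have hκ : 0 < 2 - lam := by linarith
  have := one_sub_div_pos hlam hlam_lt
  refine lt_min ?_ ?_ <;> gcongr

/-- With κ = 2 - λ, the parabola αt(1 - αt/(2κ)) has maximum κ/2, attained only at αt = κ. As μ_h ≠
L_h, at least one endpoint lies strictly below it. -/
theorem add_mul_xiH_lt_one {α lam μh Lh : ℝ} (hα : 0 < α) (hlam : lam < 2) (hμL : μh < Lh) :
    lam / 2 + α * xiH α lam μh Lh < 1 := by
  have hκ : 0 < 2 - lam := by linarith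
  have key : ∀ t : ℝ, α * t ≠ 2 - lam →
      α * (t * (1 - α * t / (2 * (2 - lam)))) < (2 - lam) / 2 := by
    intro t ht
    have e : α * (t * (1 - α * t / (2 * (2 - lam))))
        = (2 - lam) / 2 - (α * t - (2 - lam)) ^ 2 / (2 * (2 - lam)) := by
      field_simp
      ring
    have : 0 < (α * t - (2 - lam)) ^ 2 / (2 * (2 - lam)) :=
      div_pos (sq_pos_of_ne_zero (sub_ne_zero.2 ht)) (by positivity)
    linarith
  by_cases hc : α * μh = 2 - lam
  · have h1 := key Lh (by rw [← hc]; exact fun h => hμL.ne' (mul_left_cancel₀ hα.ne' h))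
    have h2 := mul_le_mul_of_nonneg_left (min_le_right (μh * (1 - α * μh / (2 * (2 - lam))))
      (Lh * (1 - α * Lh / (2 * (2 - lam))))) hα.le
    rw [xiH]
    linarith
  · have h1 := key μh hc
    have h2 := mul_le_mul_of_nonneg_left (min_le_left (μh * (1 - α * μh / (2 * (2 - lam))))
      (Lh * (1 - α * Lh / (2 * (2 - lam))))) hα.le
    rw [xiH]
    linarith

theorem rhoNewH_le_rhoOldH {α lam μh Lh : ℝ} {Lf : EReal} (hα : 0 < α) (hlam : 0 < lam)
    (hlam2 : lam < 2) (hlam_lt : lam < 2 - α * Lh / 2) (hμh : 0 ≤ μh) (hμL : μh < Lh) :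
    rhoNewH α lam Lf μh Lh ≤ rhoOldH α lam Lf μh Lh := by
  have hc := one_sub_div_pos hlam2 hlam_lt
  have hle := modulus_le_xiH hα hlam2 hlam_lt hμh hμL
  refine sqrt_factor_le hα hlam (min_le_min ?_ ?_) <;> unfold quotAt <;> split_ifs
  · exact le_trans (by positivity) hle
  · refine (div_le_self (by positivity) ?_).trans hle
    have : 0 ≤ α ^ 2 * Lf.toReal ^ 2 := by positivity
    linarith
  · exact le_rfl
  · beta_reduce
    gcongr

theorem rhoNewH_lt_rhoOldH {α lam μh Lh L : ℝ} (hα : 0 < α) (hlam : 0 < lam)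
    (hlam2 : lam < 2) (hlam_lt : lam < 2 - α * Lh / 2) (hμh : 0 < μh) (hμL : μh < Lh)
    (hL : 0 < L) :
    rhoNewH α lam L μh Lh < rhoOldH α lam L μh Lh ∧ rhoOldH α lam L μh Lh < 1 := by
  have hc := one_sub_div_pos hlam2 hlam_lt
  have hlt := modulus_lt_xiH hα hlam2 hlam_lt hμh hμL
  have hξ := add_mul_xiH_lt_one hα hlam2 hμL (μh := μh)
  unfold rhoNewH rhoOldH
  rw [quotAt_coe, quotAt_coe, quotAt_coe]
  constructor
  · refine sqrt_factor_lt hα hlam (min_lt_min ?_ ?_) ?_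
    · refine (div_le_self (by positivity) ?_).trans_lt hlt
      have : 0 ≤ α ^ 2 * L ^ 2 := by positivity
      linarith
    · gcongr
    · have := mul_le_mul_of_nonneg_left (min_le_left (xiH α lam μh Lh)
        ((L + xiH α lam μh Lh) / (1 + α * L) ^ 2)) hα.le
      linarith
  · exact sqrt_factor_lt_one hα hlam (lt_min (by positivity) (by positivity))

theorem rhoNewH_eq_rhoOldH {α lam Lh : ℝ} {Lf : EReal} (hLh : 0 < Lh)
    (hlam2 : lam < 2) (hlam_lt : lam < 2 - α * Lh / 2) :
    rhoNewH α lam Lf 0 Lh = rhoOldH α lam Lf 0 Lh := by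
  have hc := one_sub_div_pos hlam2 hlam_lt
  have hξ : xiH α lam 0 Lh = 0 := by
    rw [xiH, zero_mul]
    exact min_eq_left (by positivity)
  have h0 : quotAt (fun L => 0 * (1 - α * Lh / (2 * (2 - lam))) / (1 + α ^ 2 * L ^ 2)) Lf = 0 := by
    simp [quotAt]
  rw [rhoNewH, rhoOldH, hξ, h0, zero_mul]

end Factors

/-! ### Assembly of the three cases. -/

theorem proposition2 {H : Type*} [NormedAddCommGroup H] [InnerProductSpace ℝ H] [CompleteSpace H]
    (α lam Lh : ℝ) (hα : 0 < α) (hlam : 0 < lam) (hLh : 0 < Lh)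
    (hαLh : α * Lh < 4) (hlam_lt : lam < 2 - α * Lh / 2) :
    -- the case where `f` is strongly convex and smooth
    (∀ (μf : ℝ) (Lf : EReal), 0 ≤ μf → (μf : EReal) < Lf →
      (∀ f g h : H → EReal, FunClass μf Lf f → FunClass 0 ⊤ g → FunClass 0 (Lh : EReal) h →
        MultiOp.IsContractive (rhoOldF α lam μf Lf Lh)
          (MultiOp.davisYin (subdiff f) (subdiff g) (subdiff h) α lam) ∧
        MultiOp.IsContractive (rhoNewF α lam μf Lf Lh)
          (MultiOp.davisYin (subdiff f) (subdiff g) (subdiff h) α lam)) ∧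
      rhoNewF α lam μf Lf Lh ≤ rhoOldF α lam μf Lf Lh ∧
      (0 < μf → Lf ≠ ⊤ →
        rhoNewF α lam μf Lf Lh < rhoOldF α lam μf Lf Lh ∧ rhoOldF α lam μf Lf Lh < 1) ∧
      (μf = 0 → rhoNewF α lam μf Lf Lh = rhoOldF α lam μf Lf Lh)) ∧
    -- the case where `g` is strongly convex
    (∀ (μg : ℝ) (Lf : EReal), 0 ≤ μg → 0 < Lf →
      (∀ f g h : H → EReal, FunClass 0 Lf f → FunClass μg ⊤ g → FunClass 0 (Lh : EReal) h →
        MultiOp.IsContractive (rhoOldG α lam μg Lf)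
          (MultiOp.davisYin (subdiff f) (subdiff g) (subdiff h) α lam) ∧
        MultiOp.IsContractive (rhoNewG α lam μg Lf)
          (MultiOp.davisYin (subdiff f) (subdiff g) (subdiff h) α lam)) ∧
      rhoNewG α lam μg Lf ≤ rhoOldG α lam μg Lf ∧
      (0 < μg → Lf ≠ ⊤ → rhoOldG α lam μg Lf < 1) ∧
      (0 < μg → Lf ≠ ⊤ →
        0 < (2 - lam) * (1 - 2 * α * μg + α ^ 2 * Lf.toReal ^ 2)
          + 2 * α * μg * (1 + α ^ 2 * Lf.toReal ^ 2) →
        rhoNewG α lam μg Lf < rhoOldG α lam μg Lf)) ∧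
    -- the case where `h` is strongly convex
    (∀ (μh : ℝ) (Lf : EReal), 0 ≤ μh → μh < Lh → 0 < Lf →
      (∀ f g h : H → EReal, FunClass 0 Lf f → FunClass 0 ⊤ g → FunClass μh (Lh : EReal) h →
        MultiOp.IsContractive (rhoOldH α lam Lf μh Lh)
          (MultiOp.davisYin (subdiff f) (subdiff g) (subdiff h) α lam) ∧
        MultiOp.IsContractive (rhoNewH α lam Lf μh Lh)
          (MultiOp.davisYin (subdiff f) (subdiff g) (subdiff h) α lam)) ∧
      rhoNewH α lam Lf μh Lh ≤ rhoOldH α lam Lf μh Lh ∧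
      (0 < μh → Lf ≠ ⊤ →
        rhoNewH α lam Lf μh Lh < rhoOldH α lam Lf μh Lh ∧ rhoOldH α lam Lf μh Lh < 1) ∧
      (μh = 0 → rhoNewH α lam Lf μh Lh = rhoOldH α lam Lf μh Lh)) := by
  have hαLh0 : 0 < α * Lh := mul_pos hα hLh
  have hlam2 : lam < 2 := by linarith
  refine ⟨?_, ?_, ?_⟩
  · intro μf Lf hμf hμL
    have hle := rhoNewF_le_rhoOldF hα hlam hαLh hμf hμL
    refine ⟨fun f g h hf hg hh => ?_, hle, ?_, ?_⟩
    · have hc := isContractive_rhoNewF hα hlam hLh hαLh hlam_lt hμf hμL hf hg hh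
      -- The old factor needs no separate argument: it dominates the new one.
      exact ⟨hc.mono hle, hc⟩
    · intro hpos htop
      lift Lf to ℝ using ⟨htop, (bot_le.trans_lt hμL).ne'⟩
      exact rhoNewF_lt_rhoOldF hα hlam hLh hαLh hpos (by exact_mod_cast hμL)
    · rintro rfl
      exact rhoNewF_eq_rhoOldF hα (by exact_mod_cast hμL)
  · intro μg Lf hμg hLf
    have hle := rhoNewG_le_rhoOldG (Lf := Lf) hα hlam hlam2 hμg
    refine ⟨fun f g h hf hg hh => ?_, hle, ?_, ?_⟩
    · have hc := isContractive_rhoNewG hα hlam hLh hlam_lt hμg hLf hf hg hh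
      exact ⟨hc.mono hle, hc⟩
    · intro hpos htop
      lift Lf to ℝ using ⟨htop, (bot_le.trans_lt hLf).ne'⟩
      exact rhoOldG_lt_one hα hlam hlam2 hpos (by exact_mod_cast hLf)
    · intro hpos htop hcond
      lift Lf to ℝ using ⟨htop, (bot_le.trans_lt hLf).ne'⟩
      exact rhoNewG_lt_rhoOldG hα hlam hlam2 hpos (by exact_mod_cast hLf) hcond
  · intro μh Lf hμh hμL hLf
    have hle := rhoNewH_le_rhoOldH (Lf := Lf) hα hlam hlam2 hlam_lt hμh hμL
    refine ⟨fun f g h hf hg hh => ?_, hle, ?_, ?_⟩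
    · have hξ : 0 ≤ xiH α lam μh Lh :=
        (mul_nonneg hμh (one_sub_div_pos hlam2 hlam_lt).le).trans
          (modulus_le_xiH hα hlam2 hlam_lt hμh hμL)
      have hc := isContractive_rhoNewH hα hlam hLh hlam_lt hμh hμL hLf hf hg hh hξ
        (add_mul_xiH_lt_one hα hlam2 hμL)
      exact ⟨hc.mono hle, hc⟩
    · intro hpos htop
      lift Lf to ℝ using ⟨htop, (bot_le.trans_lt hLf).ne'⟩
      exact rhoNewH_lt_rhoOldH hα hlam hlam2 hlam_lt hpos hμL (by exact_mod_cast hLf)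
    · rintro rfl
      exact rhoNewH_eq_rhoOldH hLh hlam2 hlam_lt
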